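/- **Setting.** Let $V$ be a finite-dimensional real vector space (parameter space) and $V^*$ its dual (constraint space). A linear constraint $\langle \alpha, c\rangle$ on a real vector space $W$ consists of a linear functional $\alpha$ on $W$ and $c\in\mathbb R$; a point $b\in W$ satisfies it if $\alpha\cdot b\ge c$, and it supports $b$ if $\alpha\ne 0$ and $\alpha\cdot b=c$. For a set $S$ of linear constraints, $\mathrm{sat}(S)$ is the set of points satisfying all of them. A representation of a set $C\subseteq W$ is a finite set $S$ of linear constraints with $\mathrm{sat}(S)=C$; it is minimal if no representation of $C$ has fewer elements. Let $\Omega=\sum_{i\in I}\langle\alpha_i,c_i\rangle$ be a finite combination of linear constraints on $V$, with $\alpha_i\in V^*$ and $c_i\in\{1,0,-1\}$, and put $I_c=\{i\in I: c_i=c\}$. Assume that $\alpha_i=0$ for some $i\in I_{-1}$, and that $\alpha_i\neq0$ for all $i\in I_0$. (This is no restriction: adding $\langle 0,-1\rangle$ and dropping $\langle 0,0\rangle$ changes neither $\Omega$ nor the sets $\mathrm{reg}_c(\Omega)$.) For $c\in\{1,0,-1\}$ let $$\mathrm{reg}_c(\Omega)=\Big\{\sum_{i\in I}\lambda_i\alpha_i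 \;:\; \lambda_i\ge0,\ \sum_{i\in I_1}\lambda_i-\sum_{i\in I_{-1}}\lambda_i\ge c\Big\}\subseteq V^*.$$ For an integer $p>1$ and a sign $\pm$ let $$P_\pm=\{\alpha_i : i\in I_{\pm1}\},\qquad Z^{(p)}_\pm=\{\alpha_i+(p-1)\alpha_j : i\in I_{\pm1},\,j\in I_0\},$$ $$N^{(p)}_\pm=\{p\alpha_i+(p-1)\alpha_j : i\in I_{\pm1},\,j\in I_{\mp1}\},\qquad H^{(p)}_\pm=\mathrm{conv}\big(P_\pm\cup Z^{(p)}_\pm\cup N^{(p)}_\pm\big)\subseteq V^*.$$ **Proposition.** Let $p>1$ be any integer. For each sign, $H^{(p)}_\pm$ has a minimal representation by linear constraints on $V^*$. Let $\{\langle n_\ell,r_\ell\rangle\}_{\ell\in L}$ be any minimal representation of $H^{(p)}_\pm$, and let $M\subseteq L$ be the set of those $\ell$ for which $\langle n_\ell,r_\ell\rangle$ supports at least one point of $P_\pm$. For the sign $-$, and for the sign $+$ if $I_1\neq\emptyset$, $$\mathrm{sat}\big(\{\langle n_\ell,r_\ell\rangle\}_{\ell\in M}\big)=\mathrm{reg}_{\pm1}(\Omega),\qquad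 \mathrm{sat}\big(\{\langle n_\ell,0\rangle\}_{\ell\in M}\big)=\mathrm{reg}_0(\Omega).$$ If $I_1=\emptyset$, then $\mathrm{reg}_1(\Omega)=\emptyset$, and the construction with the sign $+$ fails: for every minimal representation of $H^{(p)}_+$, both sets on the left-hand sides are all of $V^*$ whatever $\Omega$ is; in particular the first is not $\mathrm{reg}_1(\Omega)$. So $\mathrm{reg}_0(\Omega)$ is then obtained from the sign $-$ only. -/

import Mathlib

/-- A linear constraint `⟨α, c⟩` on a real vector space `W`: the inequality `α · b ≥ c`. -/
structure LinConstraint (W : Type*) [AddCommGroup W] [Module ℝ W] where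
  normal : Module.Dual ℝ W
  offset : ℝ

namespace LinConstraint

variable {W : Type*} [AddCommGroup W] [Module ℝ W]

/-- The point `b` satisfies `⟨α, c⟩`. -/
def Satisfies (a : LinConstraint W) (b : W) : Prop := a.offset ≤ a.normal b

/-- `⟨α, c⟩` supports `b` if `α · b = c`; a constraint with `α = 0` supports no point. -/
def Supports (a : LinConstraint W) (b : W) : Prop := a.normal ≠ 0 ∧ a.normal b = a.offset

/-- The constraint with the same normal and with offset `0`. -/
def zeroOffset (a : LinConstraint W) : LinConstraint W := ⟨a.normal, 0⟩

/-- The set of points that satisfy all the constraints of `S`. -/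
def sat (S : Set (LinConstraint W)) : Set W := {b | ∀ a ∈ S, a.Satisfies b}

/-- The finite set `S` of linear constraints represents the set `C`. -/
def IsRepresentation (S : Finset (LinConstraint W)) (C : Set W) : Prop :=
  sat (S : Set (LinConstraint W)) = C

/-- A representation with the smallest number of elements. -/
def IsMinimalRepresentation (S : Finset (LinConstraint W)) (C : Set W) : Prop :=
  IsRepresentation S C ∧
    ∀ T : Finset (LinConstraint W), IsRepresentation T C → S.card ≤ T.card

/-- The elements of `L` that support at least one point of `P`. -/
def supporting (L : Finset (LinConstraint W)) (P : Set W) : Set (LinConstraint W) :=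
  {a | a ∈ L ∧ ∃ x ∈ P, a.Supports x}

end LinConstraint

/-- A combination `Ω = ∑ i, ⟨α i, c i⟩` of linear constraints on the parameter space `V`, with each
`c i` in `{1, 0, -1}`. The index set `I_c` is `{i | Ω.c i = c}`; the vectors `α i` live in
constraint space, the dual of `V`. -/
structure ConstraintSum (V : Type*) [AddCommGroup V] [Module ℝ V] (ι : Type*) where
  α : ι → Module.Dual ℝ V
  c : ι → SignType

namespace ConstraintSum

variable {V : Type*} [AddCommGroup V] [Module ℝ V] {ι : Type*}

/-- `reg_c(Ω)`: all points `∑ i, l i • α i` with `l i ≥ 0` and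
`∑_{I_1} l i - ∑_{I_{-1}} l i ≥ c`. -/
def reg [Fintype ι] (Ω : ConstraintSum V ι) (c : SignType) : Set (Module.Dual ℝ V) :=
  {β | ∃ l : ι → ℝ, (∀ i, 0 ≤ l i) ∧
    (c : ℝ) ≤ (∑ i with Ω.c i = 1, l i) - (∑ i with Ω.c i = -1, l i) ∧
    β = ∑ i, l i • Ω.α i}

/-- `P_s`, for a sign `s = ±1`. -/
def ptsP (Ω : ConstraintSum V ι) (s : SignType) : Set (Module.Dual ℝ V) :=
  {x | ∃ i, Ω.c i = s ∧ x = Ω.α i}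

/-- `Z_s^{(p)}`. -/
def ptsZ (Ω : ConstraintSum V ι) (p : ℕ) (s : SignType) : Set (Module.Dual ℝ V) :=
  {x | ∃ i j, Ω.c i = s ∧ Ω.c j = 0 ∧ x = Ω.α i + ((p : ℝ) - 1) • Ω.α j}

/-- `N_s^{(p)}`. -/
def ptsN (Ω : ConstraintSum V ι) (p : ℕ) (s : SignType) : Set (Module.Dual ℝ V) :=
  {x | ∃ i j, Ω.c i = s ∧ Ω.c j = -s ∧ x = (p : ℝ) • Ω.α i + ((p : ℝ) - 1) • Ω.α j}

/-- `H_s^{(p)}`, the convex hull of the three point sets. -/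
def hull (Ω : ConstraintSum V ι) (p : ℕ) (s : SignType) : Set (Module.Dual ℝ V) :=
  convexHull ℝ (Ω.ptsP s ∪ Ω.ptsZ p s ∪ Ω.ptsN p s)

/-- `M_s^{(p)}`, as a subset of a given set `L` of linear constraints on constraint space. -/
def selected (Ω : ConstraintSum V ι) (s : SignType)
    (L : Finset (LinConstraint (Module.Dual ℝ V))) : Set (LinConstraint (Module.Dual ℝ V)) :=
  LinConstraint.supporting L (Ω.ptsP s)

end ConstraintSum

/-! Let K be the cone generated by the vectors (α i, c i). The constraint ⟨0, -1⟩ makes reg_c the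
slice of K at height c, so by Farkas it is described by the dual cone K*: the pairs (n, t) with n (α
i) + t c i ≥ 0 for all i.

Two facts link K* to H_s. A constraint ⟨n, r⟩ valid on H_s and tight at a point of P_s gives (n, -r
s) ∈ K* (`nonneg_of_mem_selected`). Conversely, for (n, t) ∈ K* the minimum of n over H_s occurs at
some α k ∈ P_s (`exists_forall_mem_hull_le`). If b satisfies the selected constraints, a short step
from α k towards b stays in H_s, whence n b ≥ n (α k) ≥ -t s. -/

/-! ### Finitely generated cones are polyhedral -/

/-- Fourier–Motzkin elimination of a nonnegative parameter `t` from the inequalities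
`0 ≤ f (x - t • v)`. -/
theorem exists_finset_dual_sub_smul {W : Type*} [AddCommGroup W] [Module ℝ W]
    (T : Finset (Module.Dual ℝ W)) (v : W) :
    ∃ T' : Finset (Module.Dual ℝ W), ∀ x,
      (∃ t : ℝ, 0 ≤ t ∧ ∀ f ∈ T, 0 ≤ f (x - t • v)) ↔ ∀ f ∈ T', 0 ≤ f x := by
  classical
  -- Each f bounds t from above if f v > 0 and from below if f v < 0. The new functionals compare
  -- upper bounds with the lower bound 0 and, with denominators cleared, with the other lower
  -- bounds.
  refine ⟨{f ∈ T | 0 ≤ f v} ∪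
    (({f ∈ T | 0 < f v} ×ˢ {f ∈ T | f v < 0}).image fun q => q.1 v • q.2 - q.2 v • q.1),
    fun x => ⟨?_, fun h => ?_⟩⟩
  · rintro ⟨t, ht, h⟩ f hf
    simp only [map_sub, map_smul, smul_eq_mul] at h
    rw [Finset.mem_union, Finset.mem_filter, Finset.mem_image] at hf
    rcases hf with ⟨hf, hfv⟩ | ⟨⟨f₁, f₂⟩, hq, rfl⟩
    · nlinarith [h f hf, mul_nonneg ht hfv]
    · simp only [Finset.mem_product, Finset.mem_filter] at hq
      obtain ⟨⟨h₁, hv₁⟩, h₂, hv₂⟩ := hq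
      simp only [LinearMap.sub_apply, LinearMap.smul_apply, smul_eq_mul]
      nlinarith [mul_nonneg hv₁.le (h f₂ h₂), mul_nonneg (neg_nonneg.2 hv₂.le) (h f₁ h₁)]
  · have hpos : ∀ f ∈ T, 0 ≤ f v → 0 ≤ f x := fun f hf hfv =>
      h f (Finset.mem_union_left _ (Finset.mem_filter.2 ⟨hf, hfv⟩))
    have hmix : ∀ f₁ ∈ T, 0 < f₁ v → ∀ f₂ ∈ T, f₂ v < 0 → 0 ≤ f₁ v * f₂ x - f₂ v * f₁ x := by
      intro f₁ h₁ hv₁ f₂ h₂ hv₂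
      exact h _ (Finset.mem_union_right _ (Finset.mem_image.2 ⟨(f₁, f₂), by simp [*], rfl⟩))
    -- the smallest admissible value of `t`
    have hN : (insert 0 ({f ∈ T | f v < 0}.image fun f => f x / f v)).Nonempty :=
      Finset.insert_nonempty _ _
    set t := (insert 0 ({f ∈ T | f v < 0}.image fun f => f x / f v)).max' hN with ht
    have ht0 : 0 ≤ t := Finset.le_max' _ _ (Finset.mem_insert_self _ _)
    refine ⟨t, ht0, fun f hf => ?_⟩
    simp only [map_sub, map_smul, smul_eq_mul, sub_nonneg]
    rcases lt_trichotomy (f v) 0 with hfv | hfv | hfv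
    · have : f x / f v ≤ t := Finset.le_max' _ (f x / f v) (Finset.mem_insert_of_mem
        (Finset.mem_image.2 ⟨f, Finset.mem_filter.2 ⟨hf, hfv⟩, rfl⟩))
      rwa [div_le_iff_of_neg hfv] at this
    · rw [hfv, mul_zero]
      exact hpos f hf hfv.ge
    · have hmem := Finset.max'_mem _ hN
      rw [← ht, Finset.mem_insert, Finset.mem_image] at hmem
      rcases hmem with h0 | ⟨g, hg, hgt⟩
      · rw [h0, zero_mul]
        exact hpos f hf hfv.le
      · obtain ⟨hg, hgv⟩ := Finset.mem_filter.1 hg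
        have := hmix f hf hfv g hg hgv
        have hgx : g x = t * g v := by rw [← hgt, div_mul_cancel₀ _ hgv.ne]
        rw [hgx] at this
        nlinarith

/-- A finitely generated cone in a finite-dimensional space is cut out by finitely many linear
inequalities. -/
theorem exists_finset_dual_of_fg_cone {W : Type*} [AddCommGroup W] [Module ℝ W]
    [FiniteDimensional ℝ W] {κ : Type*} (s : Finset κ) (v : κ → W) :
    ∃ T : Finset (Module.Dual ℝ W), ∀ x,
      (∃ l : κ → ℝ, (∀ i ∈ s, 0 ≤ l i) ∧ x = ∑ i ∈ s, l i • v i) ↔ ∀ f ∈ T, 0 ≤ f x := by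
  classical
  induction s using Finset.induction_on with
  | empty =>
    let b := Module.finBasis ℝ W
    refine ⟨Finset.univ.image b.coord ∪ Finset.univ.image (-b.coord), fun x => ⟨?_, fun h => ?_⟩⟩
    · rintro ⟨l, -, rfl⟩ f -
      simp
    · refine ⟨0, by simp, ?_⟩
      rw [Finset.sum_empty]
      refine b.ext_elem fun i => le_antisymm ?_ ?_
      · have := h (-b.coord i) (Finset.mem_union_right _
          (Finset.mem_image_of_mem _ (Finset.mem_univ i)))
        simpa using this
      · have := h (b.coord i) (Finset.mem_union_left _
          (Finset.mem_image_of_mem _ (Finset.mem_univ i)))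
        simpa using this
  | insert a s ha ih =>
    obtain ⟨T, hT⟩ := ih
    obtain ⟨T', hT'⟩ := exists_finset_dual_sub_smul T (v a)
    refine ⟨T', fun x => ?_⟩
    rw [← hT' x]
    constructor
    · rintro ⟨l, hl, rfl⟩
      refine ⟨l a, hl a (Finset.mem_insert_self _ _), (hT _).1 ⟨l, fun i hi =>
        hl i (Finset.mem_insert_of_mem hi), ?_⟩⟩
      rw [Finset.sum_insert ha, add_sub_cancel_left]
    · rintro ⟨t, ht, h⟩
      obtain ⟨l, hl, hx⟩ := (hT _).2 h
      have hne : ∀ i ∈ s, i ≠ a := fun i hi e => ha (e ▸ hi)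
      refine ⟨Function.update l a t, fun i hi => ?_, ?_⟩
      · rcases Finset.mem_insert.1 hi with rfl | hi
        · simpa using ht
        · simpa [hne i hi] using hl i hi
      · rw [Finset.sum_insert ha, Function.update_self, Finset.sum_congr rfl fun i hi => by
          rw [Function.update_of_ne (hne i hi)], ← hx, add_sub_cancel]

/-! ### Representations of polytopes -/

namespace LinConstraint

variable {W : Type*} [AddCommGroup W] [Module ℝ W]

/-- The convex hull of a finite set has a finite representation. -/
theorem exists_isRepresentation_convexHull [FiniteDimensional ℝ W] {S : Set W} (hS : S.Finite) :
    ∃ L : Finset (LinConstraint W), IsRepresentation L (convexHull ℝ S) := by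
  classical
  lift S to Finset W using hS
  -- Homogenization: the hull is the slice at height 1 of the cone over the points (y, 1).
  obtain ⟨T, hT⟩ := exists_finset_dual_of_fg_cone S fun y => (y, (1 : ℝ))
  refine ⟨T.image fun f => ⟨f ∘ₗ LinearMap.inl ℝ W ℝ, -f (0, 1)⟩, ?_⟩
  ext x
  have hx : x ∈ convexHull ℝ (S : Set W) ↔ ∀ f ∈ T, 0 ≤ f (x, 1) := by
    rw [← hT, Finset.mem_convexHull']
    refine exists_congr fun l => and_congr_right fun _ => ?_
    rw [Prod.ext_iff, Prod.fst_sum, Prod.snd_sum]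
    simp only [Prod.smul_mk, smul_eq_mul, mul_one]
    rw [and_comm, eq_comm, eq_comm (a := (1 : ℝ))]
  rw [hx]
  simp only [sat, Finset.coe_image, Set.forall_mem_image, Set.mem_ofPred_eq, Finset.mem_coe,
    Satisfies, LinearMap.comp_apply, LinearMap.inl_apply]
  refine forall₂_congr fun f _ => ?_
  have : f (x, 1) = f (x, 0) + f (0, 1) := by rw [← map_add]; simp
  rw [this, neg_le_iff_add_nonneg]

theorem IsRepresentation.exists_isMinimalRepresentation {L : Finset (LinConstraint W)} {C : Set W}
    (hL : IsRepresentation L C) : ∃ L', IsMinimalRepresentation L' C := by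
  obtain ⟨L', hL', h⟩ := exists_minimalFor_of_wellFoundedLT
    (fun L : Finset (LinConstraint W) => IsRepresentation L C) Finset.card ⟨L, hL⟩
  exact ⟨L', hL', fun T hT => (le_total _ _).elim id (h hT)⟩

/-- If `b` satisfies the constraints of `L` that are tight at `a ∈ sat L`, then a small step from
`a` towards `b` stays in `sat L`. -/
theorem exists_add_smul_mem_sat {L : Finset (LinConstraint W)} {a b : W}
    (ha : a ∈ sat (L : Set (LinConstraint W)))
    (hb : ∀ l ∈ L, l.normal a = l.offset → l.Satisfies b) :
    ∃ ε : ℝ, 0 < ε ∧ a + ε • (b - a) ∈ sat (L : Set (LinConstraint W)) := by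
  have key : ∀ l ∈ L, ∀ᶠ ε : ℝ in nhdsWithin 0 (Set.Ioi 0), l.Satisfies (a + ε • (b - a)) := by
    intro l hl
    have hal : l.offset ≤ l.normal a := ha l hl
    simp only [Satisfies, map_add, map_smul, map_sub, smul_eq_mul]
    rcases hal.eq_or_lt with h | h
    · have hbl : l.offset ≤ l.normal b := hb l hl h.symm
      filter_upwards [self_mem_nhdsWithin] with ε hε
      have : 0 ≤ ε * (l.normal b - l.normal a) :=
        mul_nonneg (le_of_lt hε) (by linarith)
      linarith
    · have hc : Filter.Tendsto (fun ε : ℝ => l.normal a + ε * (l.normal b - l.normal a))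
          (nhdsWithin 0 (Set.Ioi 0)) (nhds (l.normal a)) := by
        have : Continuous fun ε : ℝ => l.normal a + ε * (l.normal b - l.normal a) := by fun_prop
        simpa using (this.tendsto 0).mono_left nhdsWithin_le_nhds
      exact hc.eventually_const_le h
  obtain ⟨ε, h, hε⟩ := (((Filter.eventually_all_finset L).2 key).and self_mem_nhdsWithin).exists
  exact ⟨ε, hε, h⟩

end LinConstraint

/-! ### Hulls, regions and the dual cone -/

namespace ConstraintSum

open LinConstraint

variable {V : Type*} [AddCommGroup V] [Module ℝ V] {ι : Type*}

theorem finite_generators [Finite ι] (Ω : ConstraintSum V ι) (p : ℕ) (s : SignType) :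
    (Ω.ptsP s ∪ Ω.ptsZ p s ∪ Ω.ptsN p s).Finite := by
  refine ((Set.Finite.subset (Set.finite_range Ω.α) ?_).union
    (Set.Finite.subset (Set.finite_range fun q : ι × ι => Ω.α q.1 + ((p : ℝ) - 1) • Ω.α q.2)
      ?_)).union
    (Set.Finite.subset
      (Set.finite_range fun q : ι × ι => (p : ℝ) • Ω.α q.1 + ((p : ℝ) - 1) • Ω.α q.2) ?_)
  · rintro _ ⟨i, -, rfl⟩
    exact ⟨i, rfl⟩
  · rintro _ ⟨i, j, -, -, rfl⟩
    exact ⟨(i, j), rfl⟩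
  · rintro _ ⟨i, j, -, -, rfl⟩
    exact ⟨(i, j), rfl⟩

section Constraints

variable {Ω : ConstraintSum V ι} {p : ℕ} {s : SignType}

theorem α_mem_hull {i : ι} (hi : Ω.c i = s) : Ω.α i ∈ Ω.hull p s :=
  subset_convexHull ℝ _ (Or.inl (Or.inl ⟨i, hi, rfl⟩))

theorem add_smul_mem_hull {i j : ι} (hi : Ω.c i = s) (hj : Ω.c j = 0) :
    Ω.α i + ((p : ℝ) - 1) • Ω.α j ∈ Ω.hull p s :=
  subset_convexHull ℝ _ (Or.inl (Or.inr ⟨i, j, hi, hj, rfl⟩))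

theorem smul_add_smul_mem_hull {i j : ι} (hi : Ω.c i = s) (hj : Ω.c j = -s) :
    (p : ℝ) • Ω.α i + ((p : ℝ) - 1) • Ω.α j ∈ Ω.hull p s :=
  subset_convexHull ℝ _ (Or.inr ⟨i, j, hi, hj, rfl⟩)

theorem eq_or_eq_zero_or_eq_neg (hs : s = 1 ∨ s = -1) (c : SignType) :
    c = s ∨ c = 0 ∨ c = -s := by
  rcases hs with rfl | rfl <;> revert c <;> decide

theorem cast_mul_self (hs : s = 1 ∨ s = -1) : (s : ℝ) * s = 1 := by
  rcases hs with rfl | rfl <;> simp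

/-- A constraint that is valid on `H_s^{(p)}` and tight at a point of `P_s` is nonnegative on the
generators of the cone over `reg_s(Ω)`. -/
theorem nonneg_of_mem_selected (hp : 1 < p) (hs : s = 1 ∨ s = -1)
    {L : Finset (LinConstraint (Module.Dual ℝ V))} (hL : IsRepresentation L (Ω.hull p s))
    {a : LinConstraint (Module.Dual ℝ V)} (ha : a ∈ Ω.selected s L) (i : ι) :
    0 ≤ a.normal (Ω.α i) + -(a.offset * s) * (Ω.c i : ℝ) := by
  obtain ⟨haL, _, ⟨k, hk, rfl⟩, -, hak⟩ := ha
  have hp' : 0 < (p : ℝ) - 1 := sub_pos.2 (by exact_mod_cast hp)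
  have hss := cast_mul_self hs
  have hval : ∀ x ∈ Ω.hull p s, a.offset ≤ a.normal x := by
    intro x hx
    rw [← hL] at hx
    exact hx a haL
  rcases eq_or_eq_zero_or_eq_neg hs (Ω.c i) with hi | hi | hi
  · have := hval _ (α_mem_hull hi)
    rw [hi, neg_mul, mul_assoc, hss]
    linarith
  · have := hval _ (add_smul_mem_hull hk hi)
    rw [map_add, map_smul, smul_eq_mul, hak, le_add_iff_nonneg_right] at this
    rw [hi]
    simpa using nonneg_of_mul_nonneg_right this hp'
  -- The point of N_s exceeds α k by (p - 1)(α k + α i), so tightness at α k makes the normal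
  -- nonnegative on α k + α i.
  · have := hval _ (smul_add_smul_mem_hull hk hi)
    rw [map_add, map_smul, map_smul, smul_eq_mul, smul_eq_mul, hak] at this
    have h : 0 ≤ ((p : ℝ) - 1) * (a.normal (Ω.α i) + a.offset) := by linarith
    have h' := nonneg_of_mul_nonneg_right h hp'
    have hcast : ((-s : SignType) : ℝ) = -s := by rcases hs with rfl | rfl <;> simp
    rw [hi, hcast, neg_mul_neg, mul_assoc, hss, mul_one]
    exact h'

end Constraints

theorem selected_one_eq_empty {Ω : ConstraintSum V ι} (h : ∀ i, Ω.c i ≠ 1)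
    (L : Finset (LinConstraint (Module.Dual ℝ V))) : Ω.selected 1 L = ∅ := by
  refine Set.eq_empty_of_forall_notMem ?_
  rintro _ ⟨-, _, ⟨i, hi, -⟩, -⟩
  exact h i hi

theorem sum_filter_sub_sum_filter [Fintype ι] (c : ι → SignType) (l : ι → ℝ) :
    (∑ i with c i = 1, l i) - (∑ i with c i = -1, l i) = ∑ i, l i * (c i : ℝ) := by
  rw [Finset.sum_filter, Finset.sum_filter, ← Finset.sum_sub_distrib]
  refine Finset.sum_congr rfl fun i _ => ?_
  rcases hc : c i <;> simp

variable [Fintype ι]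

/-- In the presence of a constraint `⟨0, -1⟩`, the inequality in `reg` may be replaced by an
equality: `reg_c(Ω)` is a slice of the cone generated by the vectors `(α i, c i)`. -/
theorem mem_reg_iff_exists {Ω : ConstraintSum V ι} (hneg : ∃ i, Ω.c i = -1 ∧ Ω.α i = 0)
    {c : SignType} {β : Module.Dual ℝ V} :
    β ∈ Ω.reg c ↔ ∃ l : ι → ℝ, (∀ i ∈ Finset.univ, 0 ≤ l i) ∧
      (β, (c : ℝ)) = ∑ i, l i • (Ω.α i, (Ω.c i : ℝ)) := by
  classical
  simp only [reg, Set.mem_ofPred_eq, sum_filter_sub_sum_filter, Prod.ext_iff, Prod.fst_sum,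
    Prod.snd_sum, Prod.smul_mk, smul_eq_mul, Finset.mem_univ, true_imp_iff]
  constructor
  · rintro ⟨l, hl, hc, rfl⟩
    obtain ⟨k, hck, hαk⟩ := hneg
    have hd : 0 ≤ (∑ i, l i * (Ω.c i : ℝ)) - (c : ℝ) := sub_nonneg.2 hc
    -- The surplus is added to the weight of ⟨0, -1⟩, which lowers the height to c without moving
    -- the point.
    refine ⟨fun i => l i + if i = k then (∑ i, l i * (Ω.c i : ℝ)) - (c : ℝ) else 0,
      fun i => add_nonneg (hl i) (by split_ifs <;> simp [hd]), ?_, ?_⟩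
    · simp [add_smul, Finset.sum_add_distrib, hαk]
    · simp [add_mul, Finset.sum_add_distrib, hck]
  · rintro ⟨l, hl, hβ, hc⟩
    exact ⟨l, hl, hc.le, hβ⟩

/-- Farkas' lemma for `reg_c(Ω)`. -/
theorem mem_reg_iff_forall [FiniteDimensional ℝ V] {Ω : ConstraintSum V ι}
    (hneg : ∃ i, Ω.c i = -1 ∧ Ω.α i = 0) {c : SignType} {β : Module.Dual ℝ V} :
    β ∈ Ω.reg c ↔ ∀ (n : Module.Dual ℝ (Module.Dual ℝ V)) (t : ℝ),
      (∀ i, 0 ≤ n (Ω.α i) + t * (Ω.c i : ℝ)) → 0 ≤ n β + t * (c : ℝ) := by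
  classical
  rw [mem_reg_iff_exists hneg]
  constructor
  · rintro ⟨l, hl, h⟩ n t hn
    simp only [Prod.ext_iff, Prod.fst_sum, Prod.snd_sum, Prod.smul_mk, smul_eq_mul] at h
    obtain ⟨rfl, hc⟩ := h
    rw [hc, map_sum, Finset.mul_sum, ← Finset.sum_add_distrib]
    refine Finset.sum_nonneg fun i hi => ?_
    have := mul_nonneg (hl i hi) (hn i)
    rw [map_smul, smul_eq_mul]
    linarith
  · intro h
    obtain ⟨T, hT⟩ := exists_finset_dual_of_fg_cone Finset.univ fun i => (Ω.α i, (Ω.c i : ℝ))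
    rw [hT]
    intro f hf
    have hsplit : ∀ x r, f (x, r) = (f ∘ₗ LinearMap.inl ℝ _ ℝ) x + f (0, 1) * r := by
      intro x r
      have : f (x, r) = f (x, 0) + r • f (0, 1) := by rw [← map_smul, ← map_add]; simp
      rw [this, smul_eq_mul, mul_comm]
      rfl
    rw [hsplit]
    refine h _ _ fun i => ?_
    rw [← hsplit]
    refine (hT _).1 ⟨Pi.single i 1, fun j _ => ?_, ?_⟩ f hf
    · by_cases hj : j = i
      · subst hj; simp
      · simp [hj]
    · simp [Pi.single_apply]

/-! ### Minima over the hull and the two equalities -/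

section Facets

variable {Ω : ConstraintSum V ι} {p : ℕ} {s : SignType}

/-- A functional that is nonnegative on the generators of the cone over `reg_s(Ω)` attains its
minimum over `H_s^{(p)}` at a point of `P_s`. -/
theorem exists_forall_mem_hull_le (hp : 1 < p) (hs : s = 1 ∨ s = -1) (hne : ∃ i, Ω.c i = s)
    {n : Module.Dual ℝ (Module.Dual ℝ V)} {t : ℝ}
    (hn : ∀ i, 0 ≤ n (Ω.α i) + t * (Ω.c i : ℝ)) :
    ∃ k, Ω.c k = s ∧ ∀ x ∈ Ω.hull p s, n (Ω.α k) ≤ n x := by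
  classical
  have hp' : 0 < (p : ℝ) - 1 := sub_pos.2 (by exact_mod_cast hp)
  obtain ⟨k, hk, hmin⟩ := Finset.exists_min_image {i | Ω.c i = s} (fun i => n (Ω.α i))
    (by obtain ⟨i, hi⟩ := hne; exact ⟨i, by simpa using hi⟩)
  simp only [Finset.mem_filter, Finset.mem_univ, true_and] at hk hmin
  refine ⟨k, hk, fun x hx => ?_⟩
  have hconv : Convex ℝ {y | n (Ω.α k) ≤ n y} :=
    convex_halfSpace_ge n.isLinear _
  refine convexHull_min ?_ hconv hx
  rintro _ ((⟨i, hi, rfl⟩ | ⟨i, j, hi, hj, rfl⟩) | ⟨i, j, hi, hj, rfl⟩)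
  · exact hmin i hi
  · have hj' : 0 ≤ n (Ω.α j) := by simpa [hj] using hn j
    simp only [Set.mem_ofPred_eq, map_add, map_smul, smul_eq_mul]
    linarith [hmin i hi, mul_nonneg hp'.le hj']
  · have hij : 0 ≤ n (Ω.α i) + n (Ω.α j) := by
      have h₁ := hn i
      have h₂ := hn j
      have hcast : ((-s : SignType) : ℝ) = -s := by rcases hs with rfl | rfl <;> simp
      rw [hi] at h₁
      rw [hj, hcast] at h₂
      linarith
    simp only [Set.mem_ofPred_eq, map_add, map_smul, smul_eq_mul]
    linarith [hmin i hi, mul_nonneg hp'.le hij]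

variable [FiniteDimensional ℝ V]

theorem sat_selected_eq_reg (hneg : ∃ i, Ω.c i = -1 ∧ Ω.α i = 0) (hp : 1 < p)
    (hs : s = 1 ∨ s = -1) (hne : ∃ i, Ω.c i = s)
    {L : Finset (LinConstraint (Module.Dual ℝ V))} (hL : IsRepresentation L (Ω.hull p s)) :
    sat (Ω.selected s L) = Ω.reg s := by
  have hss := cast_mul_self hs
  refine Set.Subset.antisymm (fun b hb => ?_) fun b hb a ha => ?_
  · rw [mem_reg_iff_forall hneg]
    intro n t hn
    by_contra! hlt
    obtain ⟨k, hk, hmin⟩ := exists_forall_mem_hull_le (p := p) hp hs hne hn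
    have hkmem : Ω.α k ∈ sat (L : Set (LinConstraint (Module.Dual ℝ V))) := by
      rw [hL]
      exact α_mem_hull hk
    obtain ⟨ε, hε, hmem⟩ := exists_add_smul_mem_sat (b := b) hkmem fun l hl htight => by
      -- A zero normal supports nothing, so such a constraint is never selected; being tight, it has
      -- offset 0 and holds everywhere.
      by_cases h0 : l.normal = 0
      · simp only [h0, LinearMap.zero_apply] at htight
        simp [Satisfies, h0, ← htight]
      · exact hb l ⟨hl, _, ⟨k, hk, rfl⟩, h0, htight⟩
    rw [hL] at hmem
    have h₁ := hmin _ hmem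
    rw [map_add, map_smul, map_sub, smul_eq_mul, le_add_iff_nonneg_right] at h₁
    have h₂ := nonneg_of_mul_nonneg_right h₁ hε
    have h₃ := hn k
    rw [hk] at h₃
    linarith
  · have := (mem_reg_iff_forall hneg).1 hb _ _ (nonneg_of_mem_selected hp hs hL ha)
    rw [neg_mul, mul_assoc, hss] at this
    change a.offset ≤ a.normal b
    linarith

/-- Points satisfying the constraints with zero offset are recession directions of reg_s, and a
functional bounded below on reg_s cannot decrease along them. -/
theorem sat_zeroOffset_selected_eq_reg_zero (hneg : ∃ i, Ω.c i = -1 ∧ Ω.α i = 0) (hp : 1 < p)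
    (hs : s = 1 ∨ s = -1) (hne : ∃ i, Ω.c i = s)
    {L : Finset (LinConstraint (Module.Dual ℝ V))} (hL : IsRepresentation L (Ω.hull p s)) :
    sat (zeroOffset '' Ω.selected s L) = Ω.reg 0 := by
  refine Set.Subset.antisymm (fun b hb => ?_) fun b hb => ?_
  · rw [mem_reg_iff_forall hneg]
    intro n t hn
    by_contra! hlt
    simp only [SignType.coe_zero, mul_zero, add_zero] at hlt
    obtain ⟨k, hk⟩ := hne
    have hk0 : 0 ≤ n (Ω.α k) + t * s := hk ▸ hn k
    -- the ray from `α k` in the direction `b` stays in `reg s`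
    have hray : ∀ r : ℝ, 0 ≤ r → 0 ≤ n (Ω.α k) + r * n b + t * s := by
      intro r hr
      have hmem : Ω.α k + r • b ∈ Ω.reg s := by
        rw [← sat_selected_eq_reg hneg hp hs ⟨k, hk⟩ hL]
        intro a ha
        have h₁ : a.offset ≤ a.normal (Ω.α k) := by
          have : Ω.α k ∈ sat (L : Set (LinConstraint (Module.Dual ℝ V))) := by
            rw [hL]
            exact α_mem_hull hk
          exact this a ha.1
        have h₂ : 0 ≤ a.normal b := hb _ (Set.mem_image_of_mem _ ha)
        simp only [Satisfies, map_add, map_smul, smul_eq_mul]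
        linarith [mul_nonneg hr h₂]
      simpa using (mem_reg_iff_forall hneg).1 hmem n t hn
    -- At this r the expression in `hray` equals -1.
    have := hray ((n (Ω.α k) + t * s + 1) / -n b) (div_nonneg (by linarith) (by linarith))
    have h : (n (Ω.α k) + t * s + 1) / -n b * n b = -(n (Ω.α k) + t * s + 1) := by
      rw [div_neg, neg_mul, div_mul_cancel₀ _ hlt.ne]
    linarith
  · rintro _ ⟨a, ha, rfl⟩
    have := (mem_reg_iff_forall hneg).1 hb _ _ (nonneg_of_mem_selected hp hs hL ha)
    simpa [Satisfies, zeroOffset] using this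

end Facets

theorem reg_one_eq_empty {Ω : ConstraintSum V ι} (h : ∀ i, Ω.c i ≠ 1) : Ω.reg 1 = ∅ := by
  refine Set.eq_empty_of_forall_notMem ?_
  rintro _ ⟨l, hl, hc, -⟩
  have h₁ : ∑ i with Ω.c i = 1, l i = 0 := by
    rw [Finset.filter_false_of_mem fun i _ => h i, Finset.sum_empty]
  have h₂ : 0 ≤ ∑ i with Ω.c i = -1, l i := Finset.sum_nonneg fun i _ => hl i
  rw [h₁, SignType.coe_one] at hc
  linarith

end ConstraintSum

theorem propositionB2 {V : Type*} [AddCommGroup V] [Module ℝ V] [FiniteDimensional ℝ V]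
    {ι : Type*} [Fintype ι] (Ω : ConstraintSum V ι)
    (hneg : ∃ i, Ω.c i = -1 ∧ Ω.α i = 0)
    (hzero : ∀ i, Ω.c i = 0 → Ω.α i ≠ 0)
    (p : ℕ) (hp : 1 < p) :
    -- minimal representations of the hulls exist
    (∀ s : SignType, (s = 1 ∨ s = -1) →
      ∃ L : Finset (LinConstraint (Module.Dual ℝ V)),
        LinConstraint.IsMinimalRepresentation L (Ω.hull p s)) ∧
    -- the construction, for the sign `-1`, and for the sign `1` unless `I_1` is empty
    (∀ s : SignType, (s = 1 ∧ (∃ i, Ω.c i = 1)) ∨ s = -1 →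
      ∀ L : Finset (LinConstraint (Module.Dual ℝ V)),
        LinConstraint.IsMinimalRepresentation L (Ω.hull p s) →
          LinConstraint.sat (Ω.selected s L) = Ω.reg s ∧
          LinConstraint.sat (LinConstraint.zeroOffset '' Ω.selected s L) = Ω.reg 0) ∧
    -- the exception: if `I_1` is empty, then `reg_1(Ω)` is empty, whereas the construction with the
    -- sign `1` always gives the whole constraint space
    ((∀ i, Ω.c i ≠ 1) →
      Ω.reg 1 = ∅ ∧
      ∀ L : Finset (LinConstraint (Module.Dual ℝ V)),
        LinConstraint.IsMinimalRepresentation L (Ω.hull p 1) →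
          LinConstraint.sat (Ω.selected 1 L) = Set.univ ∧
          LinConstraint.sat (Ω.selected 1 L) ≠ Ω.reg 1 ∧
          LinConstraint.sat (LinConstraint.zeroOffset '' Ω.selected 1 L) = Set.univ) := by
  refine ⟨fun s _ => ?_, fun s hs L hL => ?_, fun h => ⟨ConstraintSum.reg_one_eq_empty h,
    fun L _ => ?_⟩⟩
  · obtain ⟨L, hL⟩ :=
      LinConstraint.exists_isRepresentation_convexHull (Ω.finite_generators p s)
    exact hL.exists_isMinimalRepresentation
  · have hs' : s = 1 ∨ s = -1 := hs.imp_left And.left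
    have hne : ∃ i, Ω.c i = s := by
      rcases hs with ⟨rfl, h⟩ | rfl
      · exact h
      · exact hneg.imp fun _ => And.left
    exact ⟨ConstraintSum.sat_selected_eq_reg hneg hp hs' hne hL.1,
      ConstraintSum.sat_zeroOffset_selected_eq_reg_zero hneg hp hs' hne hL.1⟩
  · rw [ConstraintSum.selected_one_eq_empty h L, ConstraintSum.reg_one_eq_empty h, Set.image_empty]
    have hsat : LinConstraint.sat (∅ : Set (LinConstraint (Module.Dual ℝ V))) = Set.univ :=
      Set.eq_univ_of_forall fun _ _ ha => ha.elim
    exact ⟨hsat, hsat ▸ Set.univ_nonempty.ne_empty, hsat⟩
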